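/- Let $M$ be a smooth $m$-dimensional (Hausdorff) manifold. On $TM\oplus T^*M$ consider the metric $g((X,\alpha),(Y,\beta))=\frac12(\alpha(Y)+\beta(X))$ and the Courant bracket of smooth sections $[(X,\alpha),(Y,\beta)]=([X,Y],\,L_X\beta-L_Y\alpha+\frac12 d(\alpha(Y)-\beta(X)))$. A big-isotropic structure on $M$ is a smooth $g$-isotropic subbundle $E\subseteq TM\oplus T^*M$ of some rank $k$; it is integrable if its space of smooth global sections is closed under the Courant bracket. Let $E'=E^{\perp_g}\supseteq E$, let $\mathcal E_x=pr_{T_xM}E_x\subseteq\mathcal E'_x=pr_{T_xM}E'_x$, and let $\varpi_x:\mathcal E_x\times\mathcal E'_x\to\mathbb R$ be the well-defined bilinear map $\varpi_x(X,Y)=\frac12(\alpha(Y)-\beta(X))=\alpha(Y)=-\beta(X)$, where $(X,\alpha)\in E_x$ and $(Y,\beta)\in E'_x$. The Dirac extension of $E$ is the field of subspaces $$D_x(E)=\{(X,\alpha)\in T_xM\oplus T_x^*M \mid X\in\mathcal E_x,\ \alpha(Y)=\varpi_x(X,Y)\ \ \forall\, Y\in\mathcal E_x\}.$$ A characteristic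 leaf of an integrable $E$ is a maximal connected immersed submanifold $i:\mathcal S\to M$ ($i$ an injective immersion) with $i_*(T_p\mathcal S)=\mathcal E_{i(p)}$ for all $p\in\mathcal S$. For a field $P$ of subspaces $P_x\subseteq T_xM\oplus T^*_xM$, the pullback $i^*P$ is given by $$(i^*P)_p=\{(X,i^*\alpha)\mid X\in T_p\mathcal S,\ \alpha\in T^*_{i(p)}M,\ (i_*X,\alpha)\in P_{i(p)}\}.$$ **Proposition.** Let $E$ be an integrable big-isotropic structure on $M$ and $i:\mathcal S\to M$ a characteristic leaf of $E$. Then $(i^*E)_p=(i^*D(E))_p$ for every $p\in\mathcal S$. Moreover, $\sigma_p(X,Y)=\varpi_{i(p)}(i_*X,i_*Y)$ $(X,Y\in T_p\mathcal S)$ defines a smooth closed $2$-form $\sigma$ on $\mathcal S$ (a presymplectic form), and $i^*E$ is the presymplectic structure defined by it: $(i^*E)_p=\{(X,\sigma_p(X,\cdot))\mid X\in T_p\mathcal S\}$ for every $p\in\mathcal S$. -/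

import Mathlib

open Set Bundle VectorField
open scoped Manifold ContDiff

namespace BigIso

universe u v

/-! ### The big tangent bundle, its metric, its 2-form and its sections -/

section Pointwise

variable {m : ℕ} {M : Type u} [TopologicalSpace M] [ChartedSpace (EuclideanSpace ℝ (Fin m)) M]

/-- The fibre `T_x M ⊕ T_x^* M` of the big tangent bundle of the `m`-dimensional manifold `M`. -/
abbrev BigTangent (m : ℕ) {M : Type u} [TopologicalSpace M]
    [ChartedSpace (EuclideanSpace ℝ (Fin m)) M] (x : M) : Type :=
  TangentSpace (𝓡 m) x × (TangentSpace (𝓡 m) x →L[ℝ] ℝ)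

/-- The neutral metric `g((X,α),(Y,β)) = (α(Y) + β(X)) / 2`. -/
noncomputable def gPair {x : M} (a b : BigTangent m x) : ℝ := (a.2 b.1 + b.2 a.1) / 2

/-- The 2-form `ω((X,α),(Y,β)) = (α(Y) - β(X)) / 2`. -/
noncomputable def omegaPair {x : M} (a b : BigTangent m x) : ℝ := (a.2 b.1 - b.2 a.1) / 2

/-- The `g`-orthogonal space of a subspace of `T_x M ⊕ T_x^* M`. -/
noncomputable def gOrth {x : M} (P : Submodule ℝ (BigTangent m x)) : Submodule ℝ (BigTangent m x) where
  carrier := {b | ∀ a ∈ P, gPair a b = 0}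
  zero_mem' := by intro a _; simp [gPair]
  add_mem' := by
    intro b c hb hc a ha
    have h1 := hb a ha
    have h2 := hc a ha
    simp only [gPair, Prod.fst_add, Prod.snd_add, map_add, add_apply] at *
    linarith
  smul_mem' := by
    intro r b hb a ha
    have h1 := hb a ha
    simp only [gPair, Prod.smul_fst, Prod.smul_snd, map_smul, smul_apply,
      smul_eq_mul] at *
    linear_combination r * h1

/-- The projection to `T_x M` of a subspace of `T_x M ⊕ T_x^* M`. -/
noncomputable def prT {x : M} (P : Submodule ℝ (BigTangent m x)) : Submodule ℝ (TangentSpace (𝓡 m) x) :=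
  P.map (LinearMap.fst ℝ (TangentSpace (𝓡 m) x) (TangentSpace (𝓡 m) x →L[ℝ] ℝ))

theorem exists_mem_of_mem_prT {x : M} {P : Submodule ℝ (BigTangent m x)}
    {X : TangentSpace (𝓡 m) x} (h : X ∈ prT P) : ∃ a ∈ P, a.1 = X := by
  obtain ⟨a, ha, rfl⟩ := Submodule.mem_map.1 h
  exact ⟨a, ha, rfl⟩

theorem mem_prT {x : M} {P : Submodule ℝ (BigTangent m x)} {a : BigTangent m x} (h : a ∈ P) :
    a.1 ∈ prT P :=
  Submodule.mem_map.2 ⟨a, h, rfl⟩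

/-- The value `ϖ(X,Y) = ω((X,α),(Y,β))`, for some `(X,α) ∈ P` and `(Y,β) ∈ P^⊥`. -/
noncomputable def varpiVal {x : M} (P : Submodule ℝ (BigTangent m x)) (X : prT P)
    (Y : prT (gOrth P)) : ℝ :=
  omegaPair (exists_mem_of_mem_prT X.2).choose (exists_mem_of_mem_prT Y.2).choose

/-- The value `ϖ(X,Y)` does not depend on the choice of `α` and `β`, and equals `α(Y)`. -/
theorem varpiVal_eq {x : M} {P : Submodule ℝ (BigTangent m x)} {a b : BigTangent m x}
    (ha : a ∈ P) (_hb : b ∈ gOrth P) (X : prT P) (Y : prT (gOrth P)) (hX : a.1 = X)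
    (hY : b.1 = Y) : varpiVal P X Y = a.2 b.1 := by
  obtain ⟨ha', hX'⟩ := (exists_mem_of_mem_prT X.2).choose_spec
  obtain ⟨hb', hY'⟩ := (exists_mem_of_mem_prT Y.2).choose_spec
  unfold varpiVal
  set a' := (exists_mem_of_mem_prT X.2).choose
  set b' := (exists_mem_of_mem_prT Y.2).choose
  have h1 := hb' a' ha'
  have h2 := hb' a ha
  simp only [omegaPair, gPair] at *
  rw [hX'] at h1 ⊢
  rw [hX] at h2
  rw [hY'] at h1 h2 ⊢
  rw [hY]
  linarith

/-- The bilinear map `ϖ : pr P × pr P^⊥ → ℝ`. -/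
noncomputable def varpi {x : M} (P : Submodule ℝ (BigTangent m x)) :
    prT P →ₗ[ℝ] prT (gOrth P) →ₗ[ℝ] ℝ :=
  LinearMap.mk₂ ℝ (varpiVal P)
    (by
      intro X X' Y
      obtain ⟨a, ha, hX⟩ := exists_mem_of_mem_prT X.2
      obtain ⟨a', ha', hX'⟩ := exists_mem_of_mem_prT X'.2
      obtain ⟨b, hb, hY⟩ := exists_mem_of_mem_prT Y.2
      rw [varpiVal_eq (add_mem ha ha') hb (X + X') Y (by simp [hX, hX']) hY,
        varpiVal_eq ha hb X Y hX hY, varpiVal_eq ha' hb X' Y hX' hY]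
      simp)
    (by
      intro r X Y
      obtain ⟨a, ha, hX⟩ := exists_mem_of_mem_prT X.2
      obtain ⟨b, hb, hY⟩ := exists_mem_of_mem_prT Y.2
      rw [varpiVal_eq (P.smul_mem r ha) hb (r • X) Y (by simp [hX]) hY,
        varpiVal_eq ha hb X Y hX hY]
      simp)
    (by
      intro X Y Y'
      obtain ⟨a, ha, hX⟩ := exists_mem_of_mem_prT X.2
      obtain ⟨b, hb, hY⟩ := exists_mem_of_mem_prT Y.2
      obtain ⟨b', hb', hY'⟩ := exists_mem_of_mem_prT Y'.2
      rw [varpiVal_eq ha (add_mem hb hb') X (Y + Y') hX (by simp [hY, hY']),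
        varpiVal_eq ha hb X Y hX hY, varpiVal_eq ha hb' X Y' hX hY']
      simp)
    (by
      intro r X Y
      obtain ⟨a, ha, hX⟩ := exists_mem_of_mem_prT X.2
      obtain ⟨b, hb, hY⟩ := exists_mem_of_mem_prT Y.2
      rw [varpiVal_eq ha ((gOrth P).smul_mem r hb) X (r • Y) hX (by simp [hY]),
        varpiVal_eq ha hb X Y hX hY]
      simp)

/-- The derivative `X(f)` of a function along a vector field. -/
noncomputable def dirDeriv (X : ∀ x : M, TangentSpace (𝓡 m) x) (f : M → ℝ) (x : M) : ℝ :=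
  mfderiv (𝓡 m) 𝓘(ℝ, ℝ) f x (X x)

/-- The value on the vector field `Z` of the Lie derivative of the 1-form `β`:
`(L_X β)(Z) = X(β(Z)) - β([X,Z])`. -/
noncomputable def lieDerivForm (X : ∀ x : M, TangentSpace (𝓡 m) x)
    (β : ∀ x : M, TangentSpace (𝓡 m) x →L[ℝ] ℝ) (Z : ∀ x : M, TangentSpace (𝓡 m) x) (x : M) : ℝ :=
  dirDeriv X (fun y => β y (Z y)) x - β x (mlieBracket (𝓡 m) X Z x)

end Pointwise

section Smooth

variable {m : ℕ} {M : Type u} [TopologicalSpace M] [ChartedSpace (EuclideanSpace ℝ (Fin m)) M]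
  [IsManifold (𝓡 m) ∞ M]

/-- The vector field `X` is smooth on the set `U`. -/
def SmoothFieldOn (X : ∀ x : M, TangentSpace (𝓡 m) x) (U : Set M) : Prop :=
  ContMDiffOn (𝓡 m) ((𝓡 m).prod 𝓘(ℝ, EuclideanSpace ℝ (Fin m))) ∞
    (fun x => TotalSpace.mk' (EuclideanSpace ℝ (Fin m)) (E := (TangentSpace (𝓡 m) : M → Type))
      x (X x)) U

/-- The 1-form `α` is smooth on the set `U`. -/
def SmoothFormOn (α : ∀ x : M, TangentSpace (𝓡 m) x →L[ℝ] ℝ) (U : Set M) : Prop :=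
  ContMDiffOn (𝓡 m) ((𝓡 m).prod 𝓘(ℝ, EuclideanSpace ℝ (Fin m) →L[ℝ] ℝ)) ∞
    (fun x => TotalSpace.mk' (EuclideanSpace ℝ (Fin m) →L[ℝ] ℝ)
      (E := fun x : M => TangentSpace (𝓡 m) x →L[ℝ] ℝ) x (α x)) U

/-- The section `a = (X, α)` of the big tangent bundle is smooth on the set `U`. -/
def SmoothSectionOn (a : ∀ x : M, BigTangent m x) (U : Set M) : Prop :=
  SmoothFieldOn (fun x => (a x).1) U ∧ SmoothFormOn (fun x => (a x).2) U

/-- `c = [a, b]` for the Courant bracket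
`[(X,α),(Y,β)] = ([X,Y], L_X β - L_Y α + d(α(Y) - β(X)) / 2)`;
the equality of 1-forms is tested on all smooth vector fields `Z`. -/
def IsCourantBracket (a b c : ∀ x : M, BigTangent m x) : Prop :=
  (∀ x, (c x).1 = mlieBracket (𝓡 m) (fun y => (a y).1) (fun y => (b y).1) x) ∧
  ∀ Z : ∀ x : M, TangentSpace (𝓡 m) x, SmoothFieldOn Z univ → ∀ x,
    (c x).2 (Z x) =
      lieDerivForm (fun y => (a y).1) (fun y => (b y).2) Z x
      - lieDerivForm (fun y => (b y).1) (fun y => (a y).2) Z x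
      + (1 / 2) * dirDeriv Z (fun y => (a y).2 (b y).1 - (b y).2 (a y).1) x

/-- The 2-form `σ` (a section of `T^* ⊗ T^*`, skew-symmetric at each point) is smooth and closed,
i.e. it is a presymplectic form. -/
structure IsPresymplecticForm
    (σ : ∀ x : M, TangentSpace (𝓡 m) x →L[ℝ] TangentSpace (𝓡 m) x →L[ℝ] ℝ) : Prop where
  skew : ∀ x X Y, σ x X Y = - σ x Y X
  smooth : ContMDiff (𝓡 m)
    ((𝓡 m).prod 𝓘(ℝ, EuclideanSpace ℝ (Fin m) →L[ℝ] EuclideanSpace ℝ (Fin m) →L[ℝ] ℝ)) ∞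
    (fun x => TotalSpace.mk' (EuclideanSpace ℝ (Fin m) →L[ℝ] EuclideanSpace ℝ (Fin m) →L[ℝ] ℝ)
      (E := fun x : M => TangentSpace (𝓡 m) x →L[ℝ] TangentSpace (𝓡 m) x →L[ℝ] ℝ) x (σ x))
  /-- `dσ = 0`, where `dσ(X,Y,Z)` is given by the invariant formula for the exterior derivative. -/
  closed : ∀ X Y Z : ∀ x : M, TangentSpace (𝓡 m) x,
    SmoothFieldOn X univ → SmoothFieldOn Y univ → SmoothFieldOn Z univ → ∀ x,
      dirDeriv X (fun y => σ y (Y y) (Z y)) x + dirDeriv Y (fun y => σ y (Z y) (X y)) x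
        + dirDeriv Z (fun y => σ y (X y) (Y y)) x
        - σ x (mlieBracket (𝓡 m) X Y x) (Z x) - σ x (mlieBracket (𝓡 m) Y Z x) (X x)
        - σ x (mlieBracket (𝓡 m) Z X x) (Y x) = 0

end Smooth

/-! ### Big-isotropic structures -/

/-- A big-isotropic structure of rank `k` on the `m`-dimensional manifold `M`: a smooth rank `k`
subbundle of the big tangent bundle that is isotropic for the metric `g`. -/
structure BigIsotropic (m k : ℕ) (M : Type u) [TopologicalSpace M]
    [ChartedSpace (EuclideanSpace ℝ (Fin m)) M] [IsManifold (𝓡 m) ∞ M] where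
  fiber : ∀ x : M, Submodule ℝ (BigTangent m x)
  /-- every point has a neighbourhood with a smooth frame of the subbundle -/
  exists_frame : ∀ x : M, ∃ (U : Set M) (e : Fin k → ∀ y : M, BigTangent m y),
    IsOpen U ∧ x ∈ U ∧ (∀ j, SmoothSectionOn (e j) U) ∧
    ∀ y ∈ U, LinearIndependent ℝ (fun j => e j y) ∧
      Submodule.span ℝ (range fun j => e j y) = fiber y
  isotropic : ∀ x, ∀ a ∈ fiber x, ∀ b ∈ fiber x, gPair a b = 0

namespace BigIsotropic

variable {m k d : ℕ} {M : Type u} [TopologicalSpace M] [ChartedSpace (EuclideanSpace ℝ (Fin m)) M]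
  [IsManifold (𝓡 m) ∞ M]

/-- A global smooth section of `E`. -/
def IsSection (E : BigIsotropic m k M) (a : ∀ x : M, BigTangent m x) : Prop :=
  SmoothSectionOn a univ ∧ ∀ x, a x ∈ E.fiber x

/-- `E` is integrable: the space of its smooth sections is closed under the Courant bracket. -/
def Integrable (E : BigIsotropic m k M) : Prop :=
  ∀ a b, E.IsSection a → E.IsSection b → ∃ c, E.IsSection c ∧ IsCourantBracket a b c

/-- The characteristic distribution `𝓔 = pr_{TM} E`. -/
noncomputable def charDist (E : BigIsotropic m k M) (x : M) : Submodule ℝ (TangentSpace (𝓡 m) x) :=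
  prT (E.fiber x)

/-- The distribution `𝓔' = pr_{TM} E'`, where `E'` is the `g`-orthogonal bundle of `E`. -/
noncomputable def charModule (E : BigIsotropic m k M) (x : M) : Submodule ℝ (TangentSpace (𝓡 m) x) :=
  prT (gOrth (E.fiber x))

theorem charDist_le (E : BigIsotropic m k M) (x : M) : E.charDist x ≤ E.charModule x :=
  Submodule.map_mono fun b hb a ha => E.isotropic x a ha b hb

/-- The restriction of `ϖ : 𝓔 × 𝓔' → ℝ` to `𝓔 × 𝓔`. -/
noncomputable def varpiRestr (E : BigIsotropic m k M) (x : M) (X Y : E.charDist x) : ℝ :=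
  varpi (E.fiber x) X ⟨Y, E.charDist_le x Y.2⟩

/-- The canonical almost Dirac extension
`D_x(E) = {(X,α) | X ∈ 𝓔_x and α(Y) = ϖ(X,Y) for all Y ∈ 𝓔_x}`. -/
noncomputable def diracExt (E : BigIsotropic m k M) (x : M) : Submodule ℝ (BigTangent m x) where
  carrier := {a | ∃ hX : a.1 ∈ E.charDist x, ∀ Y : E.charDist x,
    a.2 Y = E.varpiRestr x ⟨a.1, hX⟩ Y}
  zero_mem' := by
    refine ⟨zero_mem _, fun Y => ?_⟩
    have h : (⟨(0 : BigTangent m x).1, zero_mem _⟩ : E.charDist x) = 0 := rfl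
    rw [h]
    unfold varpiRestr
    erw [map_zero]
    simp
  add_mem' := by
    rintro a b ⟨ha, ha'⟩ ⟨hb, hb'⟩
    refine ⟨add_mem ha hb, fun Y => ?_⟩
    have h : (⟨(a + b).1, add_mem ha hb⟩ : E.charDist x) = ⟨a.1, ha⟩ + ⟨b.1, hb⟩ := rfl
    rw [h, Prod.snd_add, add_apply, ha' Y, hb' Y]
    unfold varpiRestr
    erw [map_add]
    rfl
  smul_mem' := by
    rintro r a ⟨ha, ha'⟩
    refine ⟨Submodule.smul_mem _ r ha, fun Y => ?_⟩
    have h : (⟨(r • a).1, Submodule.smul_mem _ r ha⟩ : E.charDist x) = r • ⟨a.1, ha⟩ := rfl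
    rw [h, Prod.smul_snd, smul_apply, ha' Y]
    unfold varpiRestr
    erw [map_smul]
    rfl

/-- `i : N → M` is an integral submanifold of the characteristic distribution of `E`: a connected
manifold `N` with an injective immersion into `M` whose tangent spaces are the spaces `𝓔`. -/
structure IsIntegralManifold (E : BigIsotropic m k M) {N : Type v} [TopologicalSpace N]
    [ChartedSpace (EuclideanSpace ℝ (Fin d)) N] [IsManifold (𝓡 d) ∞ N] (i : N → M) : Prop where
  connected : ConnectedSpace N
  injective : Function.Injective i
  smooth : ContMDiff (𝓡 d) (𝓡 m) ∞ i
  immersion : ∀ p, Function.Injective (mfderiv (𝓡 d) (𝓡 m) i p)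
  tangent : ∀ p, (mfderiv (𝓡 d) (𝓡 m) i p).range = E.charDist (i p)

/-- `i : N → M` is a characteristic leaf of `E`: a maximal connected integral submanifold of the
characteristic distribution. -/
structure IsCharacteristicLeaf (E : BigIsotropic m k M) {N : Type v} [TopologicalSpace N]
    [ChartedSpace (EuclideanSpace ℝ (Fin d)) N] [IsManifold (𝓡 d) ∞ N] (i : N → M) : Prop
    extends E.IsIntegralManifold (d := d) i where
  maximal : ∀ (d' : ℕ) (N' : Type u) [TopologicalSpace N']
    [ChartedSpace (EuclideanSpace ℝ (Fin d')) N'] [IsManifold (𝓡 d') ∞ N'] (j : N' → M),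
    E.IsIntegralManifold (d := d') j → range i ⊆ range j → range j ⊆ range i

theorem IsCharacteristicLeaf.mem {E : BigIsotropic m k M} {N : Type v} [TopologicalSpace N]
    [ChartedSpace (EuclideanSpace ℝ (Fin d)) N] [IsManifold (𝓡 d) ∞ N] {i : N → M}
    (hi : E.IsCharacteristicLeaf (d := d) i) (p : N) (X : TangentSpace (𝓡 d) p) :
    mfderiv (𝓡 d) (𝓡 m) i p X ∈ E.charDist (i p) := by
  rw [← hi.tangent p]
  exact ⟨X, rfl⟩

end BigIsotropic

/-! ### Pullbacks and graphs -/

section Pullback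

variable {n m : ℕ} {N : Type v} [TopologicalSpace N] [ChartedSpace (EuclideanSpace ℝ (Fin n)) N]
  {M : Type u} [TopologicalSpace M] [ChartedSpace (EuclideanSpace ℝ (Fin m)) M]

/-- The pullback `{(X, f^* α) | X ∈ T_p N, α ∈ T^*_{f(p)} M, (f_* X, α) ∈ P_{f(p)}}` at the point
`p` of a field `P` of subspaces of the big tangent bundle of `M` by a map `f : N → M`. -/
def pullback (f : N → M) (P : ∀ x : M, Submodule ℝ (BigTangent m x)) (p : N) :
    Submodule ℝ (BigTangent n p) where
  carrier := {a | ∃ α : TangentSpace (𝓡 m) (f p) →L[ℝ] ℝ,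
    (mfderiv (𝓡 n) (𝓡 m) f p a.1, α) ∈ P (f p) ∧ a.2 = α.comp (mfderiv (𝓡 n) (𝓡 m) f p)}
  zero_mem' := ⟨0, by
    have h : ((mfderiv (𝓡 n) (𝓡 m) f p (0 : BigTangent n p).1, 0) : BigTangent m (f p)) = 0 := by
      simp
    rw [h]; exact zero_mem _, by simp⟩
  add_mem' := by
    rintro a b ⟨α, hα, ha⟩ ⟨β, hβ, hb⟩
    refine ⟨α + β, ?_, by rw [Prod.snd_add, ha, hb, ContinuousLinearMap.add_comp]⟩
    simpa using (P (f p)).add_mem hα hβ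
  smul_mem' := by
    rintro r a ⟨α, hα, ha⟩
    refine ⟨r • α, ?_, by rw [Prod.smul_snd, ha, ContinuousLinearMap.smul_comp]⟩
    simpa using (P (f p)).smul_mem r hα

/-- The graph `{(X, i(X)σ) | X ∈ T_p N}` of a 2-form at the point `p`. -/
noncomputable def graphForm (σ : ∀ p : N, TangentSpace (𝓡 n) p →L[ℝ] TangentSpace (𝓡 n) p →L[ℝ] ℝ) (p : N) :
    Submodule ℝ (BigTangent n p) :=
  LinearMap.graph (σ p : TangentSpace (𝓡 n) p →ₗ[ℝ] (TangentSpace (𝓡 n) p →L[ℝ] ℝ))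

end Pullback

end BigIso

/-! Pointwise everything is linear algebra. Since `i_*(T_pS) = 𝓔`, each `X ∈ T_pS` has a lift
`(i_*X, α) ∈ E`, and isotropy gives `α(i_*Y) = ϖ(i_*X, i_*Y) = σ(X, Y)` whichever lift is used
(`form_eq`). Hence `i^*E` is the graph of `σ`. An element of `D(E)` satisfies the same equation by
definition, and `E ⊆ D(E)`, so `i^*D(E)` is that graph too. Skewness of `σ` is isotropy again.

Smoothness and closedness are checked on induced fields. A bump function extends each element of `E`
to a global section `(X', α)`, and `X'` is `i`-related to a field on `S`, smooth because `i` is an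
immersion. These fields realize every tangent vector, and on two of them `σ` is `α(Y') ∘ i`, hence
smooth.

On three induced fields, integrability puts the Courant bracket of two sections back in `E`.
Evaluating its form part on the third field and restricting to `S` gives exactly `dσ(X, Y, Z) = 0`,
because brackets of `i`-related fields are `i`-related (`mfderiv_mlieBracket_of_related`).
Tensoriality of `dσ` (`tensorialAt_extDerivForm`) carries this to arbitrary smooth fields. -/

section

open Filter Topology ContinuousLinearMap

/-! ### Lie brackets as commutators, and brackets of related vector fields -/

section LieBracket

variable {E : Type*} [NormedAddCommGroup E] [NormedSpace ℝ E]
  {M : Type*} [TopologicalSpace M] [ChartedSpace E M]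
  {G : Type*} [NormedAddCommGroup G] [NormedSpace ℝ G]

theorem ContMDiffAt.contDiffAt_comp_extChartAt_symm {n : WithTop ℕ∞} [IsManifold 𝓘(ℝ, E) n M]
    {f : M → G} {x y : M}
    (hy : y ∈ (extChartAt 𝓘(ℝ, E) x).source) (hf : ContMDiffAt 𝓘(ℝ, E) 𝓘(ℝ, G) n f y) :
    ContDiffAt ℝ n (f ∘ (extChartAt 𝓘(ℝ, E) x).symm) (extChartAt 𝓘(ℝ, E) x y) := by
  have h2 : ContMDiffAt 𝓘(ℝ, E) 𝓘(ℝ, E) n (extChartAt 𝓘(ℝ, E) x).symm (extChartAt 𝓘(ℝ, E) x y) :=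
    (contMDiffOn_extChartAt_symm x).contMDiffAt
      ((isOpen_extChartAt_target x).mem_nhds ((extChartAt 𝓘(ℝ, E) x).map_source hy))
  exact (ContMDiffAt.comp_of_eq hf h2 ((extChartAt 𝓘(ℝ, E) x).left_inv hy)).contDiffAt

theorem ContMDiffAt.eventually_two [IsManifold 𝓘(ℝ, E) 2 M] {E' : Type*} [NormedAddCommGroup E']
    [NormedSpace ℝ E'] {M' : Type*} [TopologicalSpace M'] [ChartedSpace E' M']
    [IsManifold 𝓘(ℝ, E') 2 M'] {f : M → M'} {x : M}
    (hf : ContMDiffAt 𝓘(ℝ, E) 𝓘(ℝ, E') 2 f x) :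
    ∀ᶠ y in 𝓝 x, ContMDiffAt 𝓘(ℝ, E) 𝓘(ℝ, E') 2 f y :=
  (contMDiffAt_iff_contMDiffAt_nhds (by simp)).1 hf

theorem mvfderiv_comp_mfderiv {E' : Type*} [NormedAddCommGroup E'] [NormedSpace ℝ E']
    {M' : Type*} [TopologicalSpace M'] [ChartedSpace E' M'] {i : M → M'} {g : M' → G} {x : M}
    (hg : MDifferentiableAt 𝓘(ℝ, E') 𝓘(ℝ, G) g (i x))
    (hi : MDifferentiableAt 𝓘(ℝ, E) 𝓘(ℝ, E') i x) (v : TangentSpace 𝓘(ℝ, E) x) :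
    mvfderiv 𝓘(ℝ, E) (g ∘ i) x v = mvfderiv 𝓘(ℝ, E') g (i x) (mfderiv 𝓘(ℝ, E) 𝓘(ℝ, E') i x v) :=
  congrArg (fun l : E →L[ℝ] G => l v) (mfderiv_comp x hg hi)

theorem Filter.EventuallyEq.mvfderiv_eq {f g : M → G} {x : M} (h : f =ᶠ[𝓝 x] g)
    (v : TangentSpace 𝓘(ℝ, E) x) : mvfderiv 𝓘(ℝ, E) f x v = mvfderiv 𝓘(ℝ, E) g x v :=
  congrArg (fun l : E →L[ℝ] G => l v) h.mfderiv_eq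

variable [IsManifold 𝓘(ℝ, E) 2 M]

/-- A vector field `V` read in the preferred chart at `x`. -/
noncomputable def fieldInChart (V : ∀ x : M, TangentSpace 𝓘(ℝ, E) x) (x : M) (u : E) : E :=
  mpullbackWithin 𝓘(ℝ, E) 𝓘(ℝ, E) (extChartAt 𝓘(ℝ, E) x).symm V (range 𝓘(ℝ, E)) u

theorem fieldInChart_apply (V : ∀ x : M, TangentSpace 𝓘(ℝ, E) x) {x y : M}
    (hy : y ∈ (extChartAt 𝓘(ℝ, E) x).source) :
    fieldInChart V x (extChartAt 𝓘(ℝ, E) x y) =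
      mvfderiv 𝓘(ℝ, E) (extChartAt 𝓘(ℝ, E) x) y (V y) := by
  have h0 : (extChartAt 𝓘(ℝ, E) x).symm (extChartAt 𝓘(ℝ, E) x y) = y :=
    (extChartAt 𝓘(ℝ, E) x).left_inv hy
  -- The derivatives of the chart and of its inverse are two-sided inverses, so pulling back along
  -- the inverse chart is pushing forward by the chart.
  have key := inverse_eq (mfderivWithin_extChartAt_symm_comp_mfderiv_extChartAt' (I := 𝓘(ℝ, E)) hy)
    (mfderiv_extChartAt_comp_mfderivWithin_extChartAt_symm' (I := 𝓘(ℝ, E)) hy)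
  exact (congrArg (fun z => (inverse (mfderivWithin 𝓘(ℝ, E) 𝓘(ℝ, E) (extChartAt 𝓘(ℝ, E) x).symm
    (range 𝓘(ℝ, E)) (extChartAt 𝓘(ℝ, E) x y)) : E → E) (V z : E)) h0).trans
    (congrArg (fun l : E →L[ℝ] E => l (V y)) key)

theorem mvfderiv_eq_fderiv_comp_extChartAt {f : M → G} {x y : M}
    (hy : y ∈ (extChartAt 𝓘(ℝ, E) x).source) (hf : ContMDiffAt 𝓘(ℝ, E) 𝓘(ℝ, G) 2 f y)
    (v : TangentSpace 𝓘(ℝ, E) y) :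
    mvfderiv 𝓘(ℝ, E) f y v =
      fderiv ℝ (f ∘ (extChartAt 𝓘(ℝ, E) x).symm) (extChartAt 𝓘(ℝ, E) x y)
        (mvfderiv 𝓘(ℝ, E) (extChartAt 𝓘(ℝ, E) x) y v) := by
  have h1 := (hf.contDiffAt_comp_extChartAt_symm hy).differentiableAt two_ne_zero
  have h2 : f =ᶠ[𝓝 y] (f ∘ (extChartAt 𝓘(ℝ, E) x).symm) ∘ extChartAt 𝓘(ℝ, E) x := by
    filter_upwards [(isOpen_extChartAt_source x).mem_nhds hy] with z hz
    rw [Function.comp_apply, Function.comp_apply, (extChartAt 𝓘(ℝ, E) x).left_inv hz]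
  have h3 : MDifferentiableAt 𝓘(ℝ, E) 𝓘(ℝ, E) (extChartAt 𝓘(ℝ, E) x) y :=
    mdifferentiableAt_extChartAt (by simpa using hy)
  rw [h2.mvfderiv_eq, mvfderiv_comp_mfderiv h1.mdifferentiableAt h3]
  exact congrArg (fun l : E →L[ℝ] G => l _) (mfderiv_eq_fderiv)

theorem mvfderiv_extChartAt_mlieBracket (V W : ∀ x : M, TangentSpace 𝓘(ℝ, E) x) (x : M) :
    mvfderiv 𝓘(ℝ, E) (extChartAt 𝓘(ℝ, E) x) x (mlieBracket 𝓘(ℝ, E) V W x) =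
      lieBracket ℝ (fieldInChart V x) (fieldInChart W x) (extChartAt 𝓘(ℝ, E) x x) := by
  rw [← mlieBracketWithin_univ, mlieBracketWithin_apply]
  refine ((isInvertible_mfderiv_extChartAt (I := 𝓘(ℝ, E))
    (mem_extChartAt_source x)).self_apply_inverse _).trans ?_
  rw [show (extChartAt 𝓘(ℝ, E) x).symm ⁻¹' univ ∩ range 𝓘(ℝ, E) = univ by simp]
  exact congrFun (lieBracketWithin_univ (V := fieldInChart V x) (W := fieldInChart W x)) _

theorem differentiableAt_fieldInChart [CompleteSpace E] {V : ∀ x : M, TangentSpace 𝓘(ℝ, E) x} {x : M}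
    (hV : MDifferentiableAt 𝓘(ℝ, E) 𝓘(ℝ, E).tangent (fun y => (V y : TangentBundle 𝓘(ℝ, E) M)) x) :
    DifferentiableAt ℝ (fieldInChart V x) (extChartAt 𝓘(ℝ, E) x x) := by
  have := (mdifferentiableWithinAt_univ.2 hV).differentiableWithinAt_mpullbackWithin_vectorField
  rw [show (extChartAt 𝓘(ℝ, E) x).symm ⁻¹' univ ∩ range 𝓘(ℝ, E) = univ by simp] at this
  exact (differentiableWithinAt_univ (f := fieldInChart V x)).1 this

theorem differentiableAt_fderiv_fieldInChart [CompleteSpace E] {f : M → G}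
    {V : ∀ x : M, TangentSpace 𝓘(ℝ, E) x}
    {x : M} (hf : ContMDiffAt 𝓘(ℝ, E) 𝓘(ℝ, G) 2 f x)
    (hV : MDifferentiableAt 𝓘(ℝ, E) 𝓘(ℝ, E).tangent (fun y => (V y : TangentBundle 𝓘(ℝ, E) M)) x) :
    DifferentiableAt ℝ (fun u => fderiv ℝ (f ∘ (extChartAt 𝓘(ℝ, E) x).symm) u (fieldInChart V x u))
      (extChartAt 𝓘(ℝ, E) x x) :=
  (((hf.contDiffAt_comp_extChartAt_symm (mem_extChartAt_source x)).fderiv_right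
    (m := 1) (by norm_num)).differentiableAt one_ne_zero).clm_apply (differentiableAt_fieldInChart hV)

/-- A second derivative needs `V f` on a whole neighbourhood; there `f` is still `C^2`, so the chart
expression is valid at nearby points as well. -/
theorem mvfderiv_field_eventuallyEq {f : M → G} (V : ∀ x : M, TangentSpace 𝓘(ℝ, E) x)
    {x : M} (hf : ContMDiffAt 𝓘(ℝ, E) 𝓘(ℝ, G) 2 f x) :
    (fun y => mvfderiv 𝓘(ℝ, E) f y (V y)) =ᶠ[𝓝 x]
      (fun u => fderiv ℝ (f ∘ (extChartAt 𝓘(ℝ, E) x).symm) u (fieldInChart V x u)) ∘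
        extChartAt 𝓘(ℝ, E) x := by
  filter_upwards [hf.eventually_two, extChartAt_source_mem_nhds (I := 𝓘(ℝ, E)) x] with y hy hys
  rw [mvfderiv_eq_fderiv_comp_extChartAt hys hy, Function.comp_apply, fieldInChart_apply V hys]

/-- The derivative of a function along a vector field is differentiable. -/
theorem mdifferentiableAt_mvfderiv_field [CompleteSpace E] {f : M → G}
    {V : ∀ x : M, TangentSpace 𝓘(ℝ, E) x}
    {x : M} (hf : ContMDiffAt 𝓘(ℝ, E) 𝓘(ℝ, G) 2 f x)
    (hV : MDifferentiableAt 𝓘(ℝ, E) 𝓘(ℝ, E).tangent (fun y => (V y : TangentBundle 𝓘(ℝ, E) M)) x) :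
    MDifferentiableAt 𝓘(ℝ, E) 𝓘(ℝ, G) (fun y => mvfderiv 𝓘(ℝ, E) f y (V y)) x :=
  ((differentiableAt_fderiv_fieldInChart hf hV).mdifferentiableAt.comp x
    (mdifferentiableAt_extChartAt (mem_chart_source E x))).congr_of_eventuallyEq
      (mvfderiv_field_eventuallyEq V hf)

theorem mvfderiv_mvfderiv_field [CompleteSpace E] {f : M → G}
    {V W : ∀ x : M, TangentSpace 𝓘(ℝ, E) x}
    {x : M} (hf : ContMDiffAt 𝓘(ℝ, E) 𝓘(ℝ, G) 2 f x)
    (hV : MDifferentiableAt 𝓘(ℝ, E) 𝓘(ℝ, E).tangent (fun y => (V y : TangentBundle 𝓘(ℝ, E) M)) x) :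
    mvfderiv 𝓘(ℝ, E) (fun y => mvfderiv 𝓘(ℝ, E) f y (V y)) x (W x) =
      fderiv ℝ (fun u => fderiv ℝ (f ∘ (extChartAt 𝓘(ℝ, E) x).symm) u (fieldInChart V x u))
        (extChartAt 𝓘(ℝ, E) x x) (fieldInChart W x (extChartAt 𝓘(ℝ, E) x x)) := by
  rw [(mvfderiv_field_eventuallyEq V hf).mvfderiv_eq, mvfderiv_comp_mfderiv
    (differentiableAt_fderiv_fieldInChart hf hV).mdifferentiableAt
    (mdifferentiableAt_extChartAt (mem_chart_source E x)),
    fieldInChart_apply W (mem_extChartAt_source x)]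
  exact congrArg (fun l : E →L[ℝ] G => l _) (mfderiv_eq_fderiv)

/-- Differentiation along the Lie bracket of two vector fields is the commutator of the
differentiations along these fields. -/
theorem mvfderiv_apply_mlieBracket [CompleteSpace E] {f : M → G}
    {V W : ∀ x : M, TangentSpace 𝓘(ℝ, E) x} {x : M}
    (hf : ContMDiffAt 𝓘(ℝ, E) 𝓘(ℝ, G) 2 f x)
    (hV : MDifferentiableAt 𝓘(ℝ, E) 𝓘(ℝ, E).tangent (fun y => (V y : TangentBundle 𝓘(ℝ, E) M)) x)
    (hW : MDifferentiableAt 𝓘(ℝ, E) 𝓘(ℝ, E).tangent (fun y => (W y : TangentBundle 𝓘(ℝ, E) M)) x) :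
    mvfderiv 𝓘(ℝ, E) f x (mlieBracket 𝓘(ℝ, E) V W x) =
      mvfderiv 𝓘(ℝ, E) (fun y => mvfderiv 𝓘(ℝ, E) f y (W y)) x (V x) -
        mvfderiv 𝓘(ℝ, E) (fun y => mvfderiv 𝓘(ℝ, E) f y (V y)) x (W x) := by
  have hx := mem_extChartAt_source (I := 𝓘(ℝ, E)) x
  rw [mvfderiv_eq_fderiv_comp_extChartAt hx hf, mvfderiv_extChartAt_mlieBracket,
    mvfderiv_mvfderiv_field hf hV, mvfderiv_mvfderiv_field hf hW]
  -- In the chart this is the flat commutator formula, where symmetry of the second derivative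
  -- cancels the second-order terms.
  exact fderiv_apply_lieBracket (hf.contDiffAt_comp_extChartAt_symm hx) (by simp)
    (differentiableAt_fieldInChart hW) (differentiableAt_fieldInChart hV)

variable {E' : Type*} [NormedAddCommGroup E'] [NormedSpace ℝ E'] [CompleteSpace E']
  {M' : Type*} [TopologicalSpace M'] [ChartedSpace E' M'] [IsManifold 𝓘(ℝ, E') 2 M']

/-- Relatedness gives `V(g ∘ i) = (V'g) ∘ i` near `x`; differentiating once more is the chain rule.
-/
theorem mvfderiv_mvfderiv_field_of_related {i : M → M'} {g : M' → G}
    {V : ∀ x : M, TangentSpace 𝓘(ℝ, E) x} {V' : ∀ x : M', TangentSpace 𝓘(ℝ, E') x} {x : M}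
    (hi : ContMDiffAt 𝓘(ℝ, E) 𝓘(ℝ, E') 2 i x) (hg : ContMDiffAt 𝓘(ℝ, E') 𝓘(ℝ, G) 2 g (i x))
    (hV' : MDifferentiableAt 𝓘(ℝ, E') 𝓘(ℝ, E').tangent
      (fun y => (V' y : TangentBundle 𝓘(ℝ, E') M')) (i x))
    (hVV' : ∀ y, mfderiv 𝓘(ℝ, E) 𝓘(ℝ, E') i y (V y) = V' (i y)) (v : TangentSpace 𝓘(ℝ, E) x) :
    mvfderiv 𝓘(ℝ, E) (fun y => mvfderiv 𝓘(ℝ, E) (g ∘ i) y (V y)) x v =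
      mvfderiv 𝓘(ℝ, E') (fun z => mvfderiv 𝓘(ℝ, E') g z (V' z)) (i x)
        (mfderiv 𝓘(ℝ, E) 𝓘(ℝ, E') i x v) := by
  have heq : (fun y => mvfderiv 𝓘(ℝ, E) (g ∘ i) y (V y)) =ᶠ[𝓝 x]
      (fun z => mvfderiv 𝓘(ℝ, E') g z (V' z)) ∘ i := by
    filter_upwards [hi.eventually_two, hi.continuousAt.eventually hg.eventually_two] with y h1 h2
    rw [mvfderiv_comp_mfderiv (h2.mdifferentiableAt two_ne_zero) (h1.mdifferentiableAt two_ne_zero),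
      hVV', Function.comp_apply]
  rw [heq.mvfderiv_eq, mvfderiv_comp_mfderiv (mdifferentiableAt_mvfderiv_field hg hV')
    (hi.mdifferentiableAt two_ne_zero)]

/-- The Lie brackets of vector fields related by a map are related by this map. -/
theorem mfderiv_mlieBracket_of_related [CompleteSpace E] {i : M → M'}
    {V W : ∀ x : M, TangentSpace 𝓘(ℝ, E) x}
    {V' W' : ∀ x : M', TangentSpace 𝓘(ℝ, E') x} {x : M}
    (hi : ContMDiffAt 𝓘(ℝ, E) 𝓘(ℝ, E') 2 i x)
    (hV : MDifferentiableAt 𝓘(ℝ, E) 𝓘(ℝ, E).tangent (fun y => (V y : TangentBundle 𝓘(ℝ, E) M)) x)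
    (hW : MDifferentiableAt 𝓘(ℝ, E) 𝓘(ℝ, E).tangent (fun y => (W y : TangentBundle 𝓘(ℝ, E) M)) x)
    (hV' : MDifferentiableAt 𝓘(ℝ, E') 𝓘(ℝ, E').tangent
      (fun y => (V' y : TangentBundle 𝓘(ℝ, E') M')) (i x))
    (hW' : MDifferentiableAt 𝓘(ℝ, E') 𝓘(ℝ, E').tangent
      (fun y => (W' y : TangentBundle 𝓘(ℝ, E') M')) (i x))
    (hVV' : ∀ y, mfderiv 𝓘(ℝ, E) 𝓘(ℝ, E') i y (V y) = V' (i y))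
    (hWW' : ∀ y, mfderiv 𝓘(ℝ, E) 𝓘(ℝ, E') i y (W y) = W' (i y)) :
    mfderiv 𝓘(ℝ, E) 𝓘(ℝ, E') i x (mlieBracket 𝓘(ℝ, E) V W x) =
      mlieBracket 𝓘(ℝ, E') V' W' (i x) := by
  -- The vector-valued chart `φ` serves as test function: both sides become the commutator applied
  -- to `φ ∘ i`, and the derivative of `φ` is injective.
  have hφ : ContMDiffAt 𝓘(ℝ, E') 𝓘(ℝ, E') 2 (extChartAt 𝓘(ℝ, E') (i x)) (i x) :=
    contMDiffAt_extChartAt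
  have key : mvfderiv 𝓘(ℝ, E') (extChartAt 𝓘(ℝ, E') (i x)) (i x)
      (mfderiv 𝓘(ℝ, E) 𝓘(ℝ, E') i x (mlieBracket 𝓘(ℝ, E) V W x)) =
      mvfderiv 𝓘(ℝ, E') (extChartAt 𝓘(ℝ, E') (i x)) (i x) (mlieBracket 𝓘(ℝ, E') V' W' (i x)) := by
    rw [← mvfderiv_comp_mfderiv (hφ.mdifferentiableAt two_ne_zero)
      (hi.mdifferentiableAt two_ne_zero), mvfderiv_apply_mlieBracket (ContMDiffAt.comp x hφ hi) hV hW,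
      mvfderiv_apply_mlieBracket hφ hV' hW', mvfderiv_mvfderiv_field_of_related hi hφ hV' hVV',
      mvfderiv_mvfderiv_field_of_related hi hφ hW' hWW', hVV', hWW']
  exact (isInvertible_mfderiv_extChartAt (I := 𝓘(ℝ, E')) (mem_extChartAt_source (i x))).injective key

end LieBracket

/-! ### Smoothness criteria for sections and bundle maps -/

section VectorBundle

variable {B₁ B₂ F₁ F₂ M : Type*} {n : WithTop ℕ∞}
  {E₁ : B₁ → Type*} {E₂ : B₂ → Type*}
  [∀ x, AddCommGroup (E₁ x)] [∀ x, Module ℝ (E₁ x)] [NormedAddCommGroup F₁] [NormedSpace ℝ F₁]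
  [TopologicalSpace (TotalSpace F₁ E₁)] [∀ x, TopologicalSpace (E₁ x)]
  [∀ x, AddCommGroup (E₂ x)] [∀ x, Module ℝ (E₂ x)] [NormedAddCommGroup F₂] [NormedSpace ℝ F₂]
  [TopologicalSpace (TotalSpace F₂ E₂)] [∀ x, TopologicalSpace (E₂ x)]
  {EB₁ : Type*} [NormedAddCommGroup EB₁] [NormedSpace ℝ EB₁]
  {HB₁ : Type*} [TopologicalSpace HB₁] {IB₁ : ModelWithCorners ℝ EB₁ HB₁}
  [TopologicalSpace B₁] [ChartedSpace HB₁ B₁]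
  {EB₂ : Type*} [NormedAddCommGroup EB₂] [NormedSpace ℝ EB₂]
  {HB₂ : Type*} [TopologicalSpace HB₂] {IB₂ : ModelWithCorners ℝ EB₂ HB₂}
  [TopologicalSpace B₂] [ChartedSpace HB₂ B₂]
  {EM : Type*} [NormedAddCommGroup EM] [NormedSpace ℝ EM]
  {HM : Type*} [TopologicalSpace HM] {IM : ModelWithCorners ℝ EM HM}
  [TopologicalSpace M] [ChartedSpace HM M]
  [FiberBundle F₁ E₁] [VectorBundle ℝ F₁ E₁] [FiberBundle F₂ E₂] [VectorBundle ℝ F₂ E₂]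
  [FiniteDimensional ℝ F₁]

/-- A smooth family of continuous linear maps that is injective at a point has a smooth family of
left inverses near this point. -/
theorem ContMDiffAt.exists_leftInverse [FiniteDimensional ℝ F₂] {Φ : M → F₁ →L[ℝ] F₂} {x : M}
    (hΦ : ContMDiffAt IM 𝓘(ℝ, F₁ →L[ℝ] F₂) n Φ x) (hinj : Function.Injective (Φ x)) :
    ∃ Ψ : M → F₂ →L[ℝ] F₁, ContMDiffAt IM 𝓘(ℝ, F₂ →L[ℝ] F₁) n Ψ x ∧
      ∀ᶠ y in 𝓝 x, ∀ v, Ψ y (Φ y v) = v := by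
  have : CompleteSpace F₁ := FiniteDimensional.complete ℝ F₁
  obtain ⟨l, hl⟩ := (Φ x : F₁ →ₗ[ℝ] F₂).exists_leftInverse_of_injective
    (LinearMap.ker_eq_bot.2 hinj)
  set L : F₂ →L[ℝ] F₁ := l.toContinuousLinearMap
  have hL : L.comp (Φ x) = ContinuousLinearMap.id ℝ F₁ := by
    ext v
    exact congrArg (fun g : F₁ →ₗ[ℝ] F₁ => g v) hl
  have hLΦ : ContMDiffAt IM 𝓘(ℝ, F₁ →L[ℝ] F₁) n (fun y => L.comp (Φ y)) x :=
    contMDiffAt_const.clm_comp hΦ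
  have hinv : (L.comp (Φ x)).IsInvertible := by
    rw [hL]
    exact ⟨ContinuousLinearEquiv.refl ℝ F₁, rfl⟩
  -- With `L` a fixed left inverse of `Φ x`, the map `L ∘ Φ y` is the identity at `x`, hence
  -- invertible nearby, and `(L ∘ Φ y)⁻¹ ∘ L` is the left inverse sought.
  refine ⟨fun y => (inverse (L.comp (Φ y))).comp L, ContMDiffAt.clm_comp ?_ contMDiffAt_const, ?_⟩
  · exact ContMDiffAt.comp x (hinv.contDiffAt_map_inverse (n := n)).contMDiffAt hLΦ
  · have hopen : ∀ᶠ g in 𝓝 (L.comp (Φ x)), g.IsInvertible := by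
      obtain ⟨e, he⟩ := hinv
      rw [← he]
      filter_upwards [ContinuousLinearEquiv.nhds e] with g hg
      exact hg
    filter_upwards [hLΦ.continuousAt.eventually hopen] with y hy v
    exact hy.inverse_apply_self v

/-- If a smooth family of linear maps between the fibres of two vector bundles is injective at a
point, then a family of vectors is smooth at this point as soon as the family of the images is. -/
theorem ContMDiffAt.of_clm_apply_of_inCoordinates [FiniteDimensional ℝ F₂]
    {b₁ : M → B₁} {b₂ : M → B₂} {m₀ : M}
    {ϕ : ∀ m, E₁ (b₁ m) →L[ℝ] E₂ (b₂ m)} {v : ∀ m, E₁ (b₁ m)}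
    (hϕ : ContMDiffAt IM 𝓘(ℝ, F₁ →L[ℝ] F₂) n
      (fun m ↦ inCoordinates F₁ E₁ F₂ E₂ (b₁ m₀) (b₁ m) (b₂ m₀) (b₂ m) (ϕ m)) m₀)
    (hinj : Function.Injective (ϕ m₀))
    (hv : ContMDiffAt IM (IB₂.prod 𝓘(ℝ, F₂)) n (fun m ↦ TotalSpace.mk' F₂ (b₂ m) (ϕ m (v m))) m₀)
    (hb₁ : ContMDiffAt IM IB₁ n b₁ m₀) :
    ContMDiffAt IM (IB₁.prod 𝓘(ℝ, F₁)) n (fun m ↦ TotalSpace.mk' F₁ (b₁ m) (v m)) m₀ := by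
  rw [contMDiffAt_totalSpace] at hv ⊢
  refine ⟨hb₁, ?_⟩
  have A : ∀ᶠ m in 𝓝 m₀, b₁ m ∈ (trivializationAt F₁ E₁ (b₁ m₀)).baseSet :=
    hb₁.continuousAt ((trivializationAt F₁ E₁ (b₁ m₀)).open_baseSet.mem_nhds
      (FiberBundle.mem_baseSet_trivializationAt' (b₁ m₀)))
  have A' : ∀ᶠ m in 𝓝 m₀, b₂ m ∈ (trivializationAt F₂ E₂ (b₂ m₀)).baseSet :=
    hv.1.continuousAt ((trivializationAt F₂ E₂ (b₂ m₀)).open_baseSet.mem_nhds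
      (FiberBundle.mem_baseSet_trivializationAt' (b₂ m₀)))
  obtain ⟨Ψ, hΨ, hΨ'⟩ := hϕ.exists_leftInverse (by
    rw [inCoordinates_eq A.self_of_nhds A'.self_of_nhds]
    exact ((trivializationAt F₂ E₂ (b₂ m₀)).continuousLinearEquivAt ℝ _
      A'.self_of_nhds).injective.comp (hinj.comp ((trivializationAt F₁ E₁
        (b₁ m₀)).continuousLinearEquivAt ℝ _ A.self_of_nhds).symm.injective))
  refine (hΨ.clm_apply hv.2).congr_of_eventuallyEq ?_
  filter_upwards [A, A', hΨ'] with m hm hm' h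
  rw [← h ((trivializationAt F₁ E₁ (b₁ m₀)) ⟨b₁ m, v m⟩).2, inCoordinates_eq hm hm']
  simp [*]

variable {E₂ : B₁ → Type*}
  [∀ x, AddCommGroup (E₂ x)] [∀ x, Module ℝ (E₂ x)]
  [TopologicalSpace (TotalSpace F₂ E₂)] [∀ x, TopologicalSpace (E₂ x)]
  [FiberBundle F₂ E₂] [VectorBundle ℝ F₂ E₂]
  [∀ x, IsTopologicalAddGroup (E₂ x)] [∀ x, ContinuousSMul ℝ (E₂ x)]

/-- A section of a bundle of linear maps is smooth at a point if it maps sufficiently many smooth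
sections to smooth sections. -/
theorem contMDiffAt_hom_of_forall_exists_section {ϕ : ∀ x, E₁ x →L[ℝ] E₂ x} {x : B₁}
    (h : ∀ v : E₁ x, ∃ s : ∀ y, E₁ y, s x = v ∧
      ContMDiffAt IB₁ (IB₁.prod 𝓘(ℝ, F₁)) n (fun y ↦ TotalSpace.mk' F₁ y (s y)) x ∧
      ContMDiffAt IB₁ (IB₁.prod 𝓘(ℝ, F₂)) n (fun y ↦ TotalSpace.mk' F₂ y (ϕ y (s y))) x) :
    ContMDiffAt IB₁ (IB₁.prod 𝓘(ℝ, F₁ →L[ℝ] F₂)) n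
      (fun y ↦ TotalSpace.mk' (F₁ →L[ℝ] F₂) (E := fun y => E₁ y →L[ℝ] E₂ y) y (ϕ y)) x := by
  have : CompleteSpace F₁ := FiniteDimensional.complete ℝ F₁
  rw [contMDiffAt_hom_bundle]
  refine ⟨contMDiffAt_id, ?_⟩
  set e₁ := trivializationAt F₁ E₁ x
  set e₂ := trivializationAt F₂ E₂ x
  have hx₁ : x ∈ e₁.baseSet := FiberBundle.mem_baseSet_trivializationAt' x
  have hx₂ : x ∈ e₂.baseSet := FiberBundle.mem_baseSet_trivializationAt' x
  let b := Module.finBasis ℝ F₁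
  choose s hs hs₁ hs₂ using fun j => h ((e₁.continuousLinearEquivAt ℝ x hx₁).symm (b j))
  simp_rw [contMDiffAt_section] at hs₁ hs₂
  let c : Fin (Module.finrank ℝ F₁) → F₁ →L[ℝ] ℝ := fun j => (b.coord j).toContinuousLinearMap
  -- `A` and `C` collect the coordinates of the sections `s j` and of their images. `A` is the
  -- identity at `x`, so it is invertible nearby and `ϕ` reads `C ∘ A⁻¹` in coordinates.
  let A : B₁ → F₁ →L[ℝ] F₁ := fun y => ∑ j, (c j).smulRight (e₁ ⟨y, s j y⟩).2
  let C : B₁ → F₁ →L[ℝ] F₂ := fun y => ∑ j, (c j).smulRight (e₂ ⟨y, ϕ y (s j y)⟩).2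
  have hA : ContMDiffAt IB₁ 𝓘(ℝ, F₁ →L[ℝ] F₁) n A x := by
    refine contMDiffAt_finsetSum fun j _ => ?_
    exact ((smulRightL ℝ F₁ F₁ (c j)).contDiff.contMDiff.contMDiffAt).comp x (hs₁ j)
  have hC : ContMDiffAt IB₁ 𝓘(ℝ, F₁ →L[ℝ] F₂) n C x := by
    refine contMDiffAt_finsetSum fun j _ => ?_
    exact ((smulRightL ℝ F₁ F₂ (c j)).contDiff.contMDiff.contMDiffAt).comp x (hs₂ j)
  have hAx : A x = ContinuousLinearMap.id ℝ F₁ := by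
    ext v
    have hj : ∀ j, (e₁ ⟨x, s j x⟩).2 = b j := fun j => by
      rw [hs j]
      simpa using (e₁.continuousLinearEquivAt ℝ x hx₁).apply_symm_apply (b j)
    simp only [A, c, sum_apply, smulRight_apply, hj, id_apply]
    exact b.sum_repr v
  have hinv : (A x).IsInvertible := by
    rw [hAx]
    exact ⟨ContinuousLinearEquiv.refl ℝ F₁, rfl⟩
  have hopen : ∀ᶠ y in 𝓝 x, (A y).IsInvertible := by
    obtain ⟨e, he⟩ := hinv
    refine hA.continuousAt.eventually ?_
    rw [← he]
    filter_upwards [ContinuousLinearEquiv.nhds e] with g hg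
    exact hg
  have hAinv : ContMDiffAt IB₁ 𝓘(ℝ, F₁ →L[ℝ] F₁) n (fun y => inverse (A y)) x :=
    ContMDiffAt.comp x (hinv.contDiffAt_map_inverse (n := n)).contMDiffAt hA
  refine (hC.clm_comp hAinv).congr_of_eventuallyEq ?_
  filter_upwards [e₁.open_baseSet.mem_nhds hx₁, e₂.open_baseSet.mem_nhds hx₂, hopen] with y h₁ h₂ hy
  have hCA : C y = (inCoordinates F₁ E₁ F₂ E₂ x y x y (ϕ y)).comp (A y) := by
    rw [inCoordinates_eq h₁ h₂]
    ext v
    simp [A, C, e₁, e₂, map_sum, *]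
  rw [hCA]
  ext v
  simp [hy.self_apply_inverse]

end VectorBundle

namespace BigIso

universe u v

/-! ### Smoothness of related fields and of bilinear forms -/

section Smooth

variable {m d : ℕ} {M : Type u} [TopologicalSpace M] [ChartedSpace (EuclideanSpace ℝ (Fin m)) M]
  [IsManifold (𝓡 m) ∞ M]
  {N : Type v} [TopologicalSpace N] [ChartedSpace (EuclideanSpace ℝ (Fin d)) N]

theorem contMDiffAt_trivial_section_iff {f : N → ℝ} {p : N} :
    ContMDiffAt (𝓡 d) ((𝓡 d).prod 𝓘(ℝ, ℝ)) ∞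
      (fun q => TotalSpace.mk' ℝ (E := Bundle.Trivial N ℝ) q (f q)) p ↔
    ContMDiffAt (𝓡 d) 𝓘(ℝ, ℝ) ∞ f p := by
  rw [contMDiffAt_section]
  rfl

variable [IsManifold (𝓡 d) ∞ N]

/-- A vector field that is related by an immersion to a smooth vector field is smooth. -/
theorem SmoothFieldOn.of_related {i : N → M} (hi : ContMDiff (𝓡 d) (𝓡 m) ∞ i)
    (hinj : ∀ p, Function.Injective (mfderiv (𝓡 d) (𝓡 m) i p))
    {X : ∀ x : M, TangentSpace (𝓡 m) x} (hX : SmoothFieldOn X univ)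
    {W : ∀ p : N, TangentSpace (𝓡 d) p}
    (hW : ∀ p, mfderiv (𝓡 d) (𝓡 m) i p (W p) = X (i p)) : SmoothFieldOn W univ := by
  refine contMDiffOn_univ.2 fun p => ?_
  refine ContMDiffAt.of_clm_apply_of_inCoordinates (b₁ := id) (b₂ := i) (IB₂ := 𝓡 m)
    (E₂ := (TangentSpace (𝓡 m) : M → Type)) (ϕ := fun p => mfderiv (𝓡 d) (𝓡 m) i p)
    ((hi p).mfderiv_const (by simp)) (hinj p) ?_ contMDiffAt_id
  simp_rw [hW]
  exact (contMDiffOn_univ.1 hX (i p)).comp p (hi p)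

/-- The value of a smooth 1-form on a smooth vector field is smooth. -/
theorem SmoothFormOn.apply {α : ∀ x : M, TangentSpace (𝓡 m) x →L[ℝ] ℝ}
    {X : ∀ x : M, TangentSpace (𝓡 m) x} (hα : SmoothFormOn α univ) (hX : SmoothFieldOn X univ) :
    ContMDiff (𝓡 m) 𝓘(ℝ, ℝ) ∞ fun x => α x (X x) := fun x =>
  contMDiffAt_trivial_section_iff.1 (ContMDiffAt.clm_bundle_apply
    (E₂ := Bundle.Trivial M ℝ) (contMDiffOn_univ.1 hα x) (contMDiffOn_univ.1 hX x))

/-- A field of bilinear forms is smooth if its values on sufficiently many smooth vector fields are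
smooth. -/
theorem contMDiff_bilinear_of_forall_exists_field
    {σ : ∀ p : N, TangentSpace (𝓡 d) p →L[ℝ] TangentSpace (𝓡 d) p →L[ℝ] ℝ}
    (S : Set (∀ p : N, TangentSpace (𝓡 d) p))
    (hS : ∀ X ∈ S, SmoothFieldOn X univ)
    (hev : ∀ p, ∀ v : TangentSpace (𝓡 d) p, ∃ X ∈ S, X p = v)
    (hσ : ∀ X ∈ S, ∀ Y ∈ S, ContMDiff (𝓡 d) 𝓘(ℝ, ℝ) ∞ fun p => σ p (X p) (Y p)) :
    ContMDiff (𝓡 d)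
    ((𝓡 d).prod 𝓘(ℝ, EuclideanSpace ℝ (Fin d) →L[ℝ] EuclideanSpace ℝ (Fin d) →L[ℝ] ℝ)) ∞
    (fun x => TotalSpace.mk' (EuclideanSpace ℝ (Fin d) →L[ℝ] EuclideanSpace ℝ (Fin d) →L[ℝ] ℝ)
      (E := fun x : N => TangentSpace (𝓡 d) x →L[ℝ] TangentSpace (𝓡 d) x →L[ℝ] ℝ) x (σ x)) := by
  intro p
  -- The criterion is used twice: for `σ` as a map from `TN` to `T^*N`, then for each 1-form `σ(X,
  -- ·)`.
  refine contMDiffAt_hom_of_forall_exists_section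
    (E₂ := fun x : N => TangentSpace (𝓡 d) x →L[ℝ] ℝ) fun v => ?_
  obtain ⟨X, hX, rfl⟩ := hev p v
  refine ⟨X, rfl, contMDiffOn_univ.1 (hS X hX) p, ?_⟩
  refine contMDiffAt_hom_of_forall_exists_section (E₂ := Bundle.Trivial N ℝ) fun w => ?_
  obtain ⟨Y, hY, rfl⟩ := hev p w
  exact ⟨Y, rfl, contMDiffOn_univ.1 (hS Y hY) p, contMDiffAt_trivial_section_iff.2 (hσ X hX Y hY p)⟩

end Smooth

/-! ### Directional derivatives and tensoriality of the exterior derivative -/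

section ExteriorDerivative

variable {d : ℕ} {N : Type v} [TopologicalSpace N] [ChartedSpace (EuclideanSpace ℝ (Fin d)) N]

theorem dirDeriv_congr {X : ∀ p : N, TangentSpace (𝓡 d) p} {f g : N → ℝ} (h : ∀ p, f p = g p)
    (p : N) : dirDeriv X f p = dirDeriv X g p := by
  rw [funext h]

theorem dirDeriv_add {X : ∀ p : N, TangentSpace (𝓡 d) p} {f g : N → ℝ} {p : N}
    (hf : MDifferentiableAt (𝓡 d) 𝓘(ℝ, ℝ) f p) (hg : MDifferentiableAt (𝓡 d) 𝓘(ℝ, ℝ) g p) :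
    dirDeriv X (fun q => f q + g q) p = dirDeriv X f p + dirDeriv X g p :=
  congrArg (fun l => l (X p)) (mvfderiv_add hf hg)

theorem dirDeriv_mul {X : ∀ p : N, TangentSpace (𝓡 d) p} {f g : N → ℝ} {p : N}
    (hf : MDifferentiableAt (𝓡 d) 𝓘(ℝ, ℝ) f p) (hg : MDifferentiableAt (𝓡 d) 𝓘(ℝ, ℝ) g p) :
    dirDeriv X (fun q => f q * g q) p = f p * dirDeriv X g p + g p * dirDeriv X f p :=
  congrArg (fun l => l (X p)) (mvfderiv_mul hf hg)

theorem dirDeriv_const_mul {X : ∀ p : N, TangentSpace (𝓡 d) p} {f : N → ℝ} {p : N} (c : ℝ)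
    (hf : MDifferentiableAt (𝓡 d) 𝓘(ℝ, ℝ) f p) :
    dirDeriv X (fun q => c * f q) p = c * dirDeriv X f p := by
  rw [dirDeriv_mul mdifferentiableAt_const hf]
  have : dirDeriv X (fun _ : N => c) p = 0 := congrArg (fun l => l (X p)) (mvfderiv_const c)
  rw [this]
  ring

theorem dirDeriv_neg (X : ∀ p : N, TangentSpace (𝓡 d) p) (f : N → ℝ) (p : N) :
    dirDeriv X (fun q => - f q) p = - dirDeriv X f p :=
  congrArg (fun l => l (X p)) (mvfderiv_neg (g := f) (x := p))

/-- The chain rule; it moves the derivatives in the Courant bracket from `M` to the leaf. -/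
theorem dirDeriv_of_related {m : ℕ} {M : Type u} [TopologicalSpace M]
    [ChartedSpace (EuclideanSpace ℝ (Fin m)) M] {i : N → M}
    {X : ∀ p : N, TangentSpace (𝓡 d) p} {X' : ∀ x : M, TangentSpace (𝓡 m) x}
    {f : M → ℝ} {g : N → ℝ} {p : N} (hi : ContMDiff (𝓡 d) (𝓡 m) ∞ i)
    (hX : mfderiv (𝓡 d) (𝓡 m) i p (X p) = X' (i p)) (hf : ContMDiff (𝓡 m) 𝓘(ℝ, ℝ) ∞ f)
    (hfg : ∀ q, f (i q) = g q) : dirDeriv X' f (i p) = dirDeriv X g p := by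
  have hg : g = f ∘ i := funext fun q => (hfg q).symm
  unfold dirDeriv
  rw [hg, ← hX, mfderiv_comp p ((hf (i p)).mdifferentiableAt (by simp))
    ((hi p).mdifferentiableAt (by simp))]
  rfl

theorem dirDeriv_field_add (X Y : ∀ p : N, TangentSpace (𝓡 d) p) (f : N → ℝ) (p : N) :
    dirDeriv (X + Y) f p = dirDeriv X f p + dirDeriv Y f p :=
  map_add (mvfderiv (𝓡 d) f p) (X p) (Y p)

theorem dirDeriv_field_smul (g : N → ℝ) (X : ∀ p : N, TangentSpace (𝓡 d) p) (f : N → ℝ) (p : N) :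
    dirDeriv (g • X) f p = g p * dirDeriv X f p :=
  map_smul (mvfderiv (𝓡 d) f p) (g p) (X p)

theorem mdifferentiableAt_trivial_section_iff {f : N → ℝ} {p : N} :
    MDifferentiableAt (𝓡 d) ((𝓡 d).prod 𝓘(ℝ, ℝ))
      (fun q => TotalSpace.mk' ℝ (E := Bundle.Trivial N ℝ) q (f q)) p ↔
    MDifferentiableAt (𝓡 d) 𝓘(ℝ, ℝ) f p := by
  rw [mdifferentiableAt_section]
  rfl

variable {σ : ∀ p : N, TangentSpace (𝓡 d) p →L[ℝ] TangentSpace (𝓡 d) p →L[ℝ] ℝ} {p : N}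

/-- The value of the exterior derivative of the 2-form `σ` on three vector fields. -/
noncomputable def extDerivForm
    (σ : ∀ p : N, TangentSpace (𝓡 d) p →L[ℝ] TangentSpace (𝓡 d) p →L[ℝ] ℝ)
    (X Y Z : ∀ p : N, TangentSpace (𝓡 d) p) (x : N) : ℝ :=
  dirDeriv X (fun y => σ y (Y y) (Z y)) x + dirDeriv Y (fun y => σ y (Z y) (X y)) x
    + dirDeriv Z (fun y => σ y (X y) (Y y)) x
    - σ x (mlieBracket (𝓡 d) X Y x) (Z x) - σ x (mlieBracket (𝓡 d) Y Z x) (X x)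
    - σ x (mlieBracket (𝓡 d) Z X x) (Y x)

/-- Cyclic symmetry lets tensoriality in the first argument serve for all three. -/
theorem extDerivForm_rotate (X Y Z : ∀ p : N, TangentSpace (𝓡 d) p) :
    extDerivForm σ X Y Z p = extDerivForm σ Y Z X p := by
  unfold extDerivForm
  ring

variable [IsManifold (𝓡 d) ∞ N]

/-- The vector field `X` is differentiable at the point `p`. -/
abbrev DiffFieldAt (X : ∀ p : N, TangentSpace (𝓡 d) p) (p : N) : Prop :=
  MDifferentiableAt (𝓡 d) (𝓡 d).tangent (fun q => (X q : TangentBundle (𝓡 d) N)) p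

theorem SmoothFieldOn.diffFieldAt {X : ∀ p : N, TangentSpace (𝓡 d) p} (hX : SmoothFieldOn X univ)
    (p : N) : DiffFieldAt X p :=
  (contMDiffOn_univ.1 hX p).mdifferentiableAt (by simp)

/-- The 2-form `σ` is differentiable at the point `p`. -/
abbrev DiffBilinAt (σ : ∀ p : N, TangentSpace (𝓡 d) p →L[ℝ] TangentSpace (𝓡 d) p →L[ℝ] ℝ)
    (p : N) : Prop :=
  MDifferentiableAt (𝓡 d)
    ((𝓡 d).prod 𝓘(ℝ, EuclideanSpace ℝ (Fin d) →L[ℝ] EuclideanSpace ℝ (Fin d) →L[ℝ] ℝ))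
    (fun x => TotalSpace.mk' (EuclideanSpace ℝ (Fin d) →L[ℝ] EuclideanSpace ℝ (Fin d) →L[ℝ] ℝ)
      (E := fun x : N => TangentSpace (𝓡 d) x →L[ℝ] TangentSpace (𝓡 d) x →L[ℝ] ℝ) x (σ x)) p

theorem DiffBilinAt.apply {X Y : ∀ p : N, TangentSpace (𝓡 d) p} (hσ : DiffBilinAt σ p)
    (hX : DiffFieldAt X p) (hY : DiffFieldAt Y p) :
    MDifferentiableAt (𝓡 d) 𝓘(ℝ, ℝ) (fun q => σ q (X q) (Y q)) p :=
  mdifferentiableAt_trivial_section_iff.1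
    (MDifferentiableAt.clm_bundle_apply₂ (E₃ := Bundle.Trivial N ℝ) hσ hX hY)

/-- Replacing `X` by `fX` produces derivatives of `f` twice in the derivative terms and twice in the
brackets. The `Z(f)` terms cancel outright, the `Y(f)` terms by skewness of `σ`. -/
theorem tensorialAt_extDerivForm (hσ : DiffBilinAt σ p) (hskew : ∀ p X Y, σ p X Y = - σ p Y X)
    {Y Z : ∀ p : N, TangentSpace (𝓡 d) p} (hY : DiffFieldAt Y p) (hZ : DiffFieldAt Z p) :
    TensorialAt (𝓡 d) (EuclideanSpace ℝ (Fin d))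
      (fun X : ∀ p : N, TangentSpace (𝓡 d) p => extDerivForm σ X Y Z p) p where
  smul := by
    intro f X hf hX
    have lin : ∀ (a b : ℝ) (u v w : TangentSpace (𝓡 d) p),
        σ p (a • u + b • v) w = a * σ p u w + b * σ p v w := by
      intro a b u v w
      rw [map_add, map_smul, map_smul]
      rfl
    have h1 : dirDeriv Y (fun y => σ y (Z y) ((f • X) y)) p =
        f p * dirDeriv Y (fun y => σ y (Z y) (X y)) p + σ p (Z p) (X p) * dirDeriv Y f p := by
      rw [← dirDeriv_mul hf (hσ.apply hZ hX)]
      exact dirDeriv_congr (fun q => map_smul (σ q (Z q)) (f q) (X q)) p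
    have h2 : dirDeriv Z (fun y => σ y ((f • X) y) (Y y)) p =
        f p * dirDeriv Z (fun y => σ y (X y) (Y y)) p + σ p (X p) (Y p) * dirDeriv Z f p := by
      rw [← dirDeriv_mul hf (hσ.apply hX hY)]
      refine dirDeriv_congr (fun q => ?_) p
      rw [Pi.smul_apply', map_smul]
      rfl
    have h3 : σ p (mlieBracket (𝓡 d) (f • X) Y p) (Z p) =
        - dirDeriv Y f p * σ p (X p) (Z p) + f p * σ p (mlieBracket (𝓡 d) X Y p) (Z p) := by
      rw [mlieBracket_smul_left hf hX]
      exact lin _ _ _ _ _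
    have h4 : σ p (mlieBracket (𝓡 d) Z (f • X) p) (Y p) =
        dirDeriv Z f p * σ p (X p) (Y p) + f p * σ p (mlieBracket (𝓡 d) Z X p) (Y p) := by
      rw [mlieBracket_smul_right hf hX]
      exact lin _ _ _ _ _
    have h5 : σ p (mlieBracket (𝓡 d) Y Z p) ((f • X) p) =
        f p * σ p (mlieBracket (𝓡 d) Y Z p) (X p) := map_smul _ (f p) (X p)
    simp only [extDerivForm, smul_eq_mul]
    rw [dirDeriv_field_smul, h1, h2, h3, h4, h5, hskew p (Z p) (X p)]
    ring
  add := by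
    intro X X' hX hX'
    have h1 : dirDeriv Y (fun y => σ y (Z y) ((X + X') y)) p =
        dirDeriv Y (fun y => σ y (Z y) (X y)) p + dirDeriv Y (fun y => σ y (Z y) (X' y)) p := by
      rw [← dirDeriv_add (hσ.apply hZ hX) (hσ.apply hZ hX')]
      exact dirDeriv_congr (fun q => map_add (σ q (Z q)) (X q) (X' q)) p
    have h2 : dirDeriv Z (fun y => σ y ((X + X') y) (Y y)) p =
        dirDeriv Z (fun y => σ y (X y) (Y y)) p + dirDeriv Z (fun y => σ y (X' y) (Y y)) p := by
      rw [← dirDeriv_add (hσ.apply hX hY) (hσ.apply hX' hY)]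
      refine dirDeriv_congr (fun q => ?_) p
      rw [Pi.add_apply, map_add]
      rfl
    have h5 : σ p (mlieBracket (𝓡 d) Y Z p) ((X + X') p) =
        σ p (mlieBracket (𝓡 d) Y Z p) (X p) + σ p (mlieBracket (𝓡 d) Y Z p) (X' p) :=
      map_add _ (X p) (X' p)
    simp only [extDerivForm]
    rw [dirDeriv_field_add, h1, h2, h5, mlieBracket_add_left hX hX', mlieBracket_add_right hX hX',
      map_add, map_add, add_apply, add_apply]
    ring

/-- The exterior derivative of a 2-form depends only on the values of the vector fields. -/
theorem extDerivForm_eq_of_apply_eq (hσ : DiffBilinAt σ p) (hskew : ∀ p X Y, σ p X Y = - σ p Y X)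
    {X Y Z X' Y' Z' : ∀ p : N, TangentSpace (𝓡 d) p} (hX : DiffFieldAt X p) (hY : DiffFieldAt Y p)
    (hZ : DiffFieldAt Z p) (hX' : DiffFieldAt X' p) (hY' : DiffFieldAt Y' p)
    (hZ' : DiffFieldAt Z' p) (h₁ : X p = X' p) (h₂ : Y p = Y' p) (h₃ : Z p = Z' p) :
    extDerivForm σ X Y Z p = extDerivForm σ X' Y' Z' p := by
  have : IsManifold (𝓡 d) 2 N := inferInstance
  rw [(tensorialAt_extDerivForm hσ hskew hY hZ).pointwise hX hX' h₁, extDerivForm_rotate,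
    (tensorialAt_extDerivForm hσ hskew hZ hX').pointwise hY hY' h₂, extDerivForm_rotate,
    (tensorialAt_extDerivForm hσ hskew hX' hY').pointwise hZ hZ' h₃, extDerivForm_rotate]

end ExteriorDerivative

/-! ### The induced form on integral submanifolds and the two pullbacks -/

section Dirac

variable {m k d : ℕ} {M : Type u} [TopologicalSpace M] [ChartedSpace (EuclideanSpace ℝ (Fin m)) M]
  [IsManifold (𝓡 m) ∞ M]

theorem SmoothFieldOn.smul_of_tsupport {X : ∀ x : M, TangentSpace (𝓡 m) x} {U : Set M} {f : M → ℝ}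
    (hf : ContMDiff (𝓡 m) 𝓘(ℝ, ℝ) ∞ f) (hU : IsOpen U) (hfU : tsupport f ⊆ U)
    (hX : SmoothFieldOn X U) : SmoothFieldOn (f • X) univ :=
  contMDiffOn_univ.2 (ContMDiffOn.smul_section_of_tsupport hf.contMDiffOn hU hfU hX)

theorem SmoothFormOn.smul_of_tsupport {α : ∀ x : M, TangentSpace (𝓡 m) x →L[ℝ] ℝ} {U : Set M}
    {f : M → ℝ} (hf : ContMDiff (𝓡 m) 𝓘(ℝ, ℝ) ∞ f) (hU : IsOpen U) (hfU : tsupport f ⊆ U)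
    (hα : SmoothFormOn α U) : SmoothFormOn (fun x => f x • α x) univ :=
  contMDiffOn_univ.2 (ContMDiffOn.smul_section_of_tsupport
    (V := fun x : M => TangentSpace (𝓡 m) x →L[ℝ] Bundle.Trivial M ℝ x)
    hf.contMDiffOn hU hfU hα)

theorem SmoothFieldOn.sum {ι : Type*} [Fintype ι] {X : ι → ∀ x : M, TangentSpace (𝓡 m) x}
    {U : Set M} (c : ι → ℝ) (hX : ∀ j, SmoothFieldOn (X j) U) :
    SmoothFieldOn (fun x => ∑ j, c j • X j x) U :=
  ContMDiffOn.sum_section fun j _ => (hX j).const_smul_section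

theorem SmoothFormOn.sum {ι : Type*} [Fintype ι] {α : ι → ∀ x : M, TangentSpace (𝓡 m) x →L[ℝ] ℝ}
    {U : Set M} (c : ι → ℝ) (hα : ∀ j, SmoothFormOn (α j) U) :
    SmoothFormOn (fun x => ∑ j, c j • α j x) U :=
  ContMDiffOn.sum_section (V := fun x : M => TangentSpace (𝓡 m) x →L[ℝ] Bundle.Trivial M ℝ x)
    fun j _ => (hα j).const_smul_section

namespace BigIsotropic

/-- Every element of a big-isotropic structure extends to a global smooth section. -/
theorem exists_isSection [T2Space M] (E : BigIsotropic m k M) {x : M} {a : BigTangent m x}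
    (ha : a ∈ E.fiber x) : ∃ s, E.IsSection s ∧ s x = a := by
  obtain ⟨U, e, hU, hxU, he, hspan⟩ := E.exists_frame x
  rw [← (hspan x hxU).2, Submodule.mem_span_range_iff_exists_fun] at ha
  obtain ⟨c, hc⟩ := ha
  -- The extension is a constant-coefficient combination of the local frame, cut off by a bump
  -- function supported in `U` and equal to 1 at `x`.
  obtain ⟨ψ, -, hψ⟩ := (SmoothBumpFunction.nhds_basis_tsupport (I := 𝓡 m) x).mem_iff.1
    (hU.mem_nhds hxU)
  refine ⟨fun y => ψ y • ∑ j, c j • e j y, ⟨⟨?_, ?_⟩, fun y => ?_⟩, ?_⟩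
  · have h := (SmoothFieldOn.sum c fun j => (he j).1).smul_of_tsupport ψ.contMDiff hU hψ
    simp only [Prod.smul_fst, Prod.fst_sum]
    exact h
  · have h := (SmoothFormOn.sum c fun j => (he j).2).smul_of_tsupport ψ.contMDiff hU hψ
    simp only [Prod.smul_snd, Prod.snd_sum]
    exact h
  · by_cases hy : y ∈ U
    · rw [← (hspan y hy).2]
      exact Submodule.smul_mem _ _ (Submodule.sum_mem _ fun j _ =>
        Submodule.smul_mem _ _ (Submodule.subset_span (mem_range_self j)))
    · have : ψ y = 0 := image_eq_zero_of_notMem_tsupport fun h => hy (hψ h)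
      simp only [this, zero_smul]
      exact zero_mem _
  · simp only [ψ.eq_one, one_smul, hc]

/-- By isotropy a lift of `Y` to `E` also lies in `E'`, so it may be used to evaluate `ϖ`. -/
theorem varpiRestr_eq (E : BigIsotropic m k M) {x : M} {a : BigTangent m x} (ha : a ∈ E.fiber x)
    (X Y : E.charDist x) (hX : a.1 = X) : E.varpiRestr x X Y = a.2 Y := by
  obtain ⟨b, hb, hY⟩ := exists_mem_of_mem_prT Y.2
  rw [← hY]
  exact varpiVal_eq ha (fun c hc => E.isotropic x c hc b hb) X ⟨Y, E.charDist_le x Y.2⟩ hX hY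

variable {N : Type v} [TopologicalSpace N] [ChartedSpace (EuclideanSpace ℝ (Fin d)) N]
  [IsManifold (𝓡 d) ∞ N] {E : BigIsotropic m k M} {i : N → M}

theorem IsIntegralManifold.mem (hi : E.IsIntegralManifold (d := d) i) (p : N)
    (X : TangentSpace (𝓡 d) p) : mfderiv (𝓡 d) (𝓡 m) i p X ∈ E.charDist (i p) := by
  rw [← hi.tangent p]
  exact ⟨X, rfl⟩

/-- The 2-form induced by `ϖ` on an integral submanifold of the characteristic distribution. -/
noncomputable def IsIntegralManifold.form (hi : E.IsIntegralManifold (d := d) i) (p : N) :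
    TangentSpace (𝓡 d) p →L[ℝ] TangentSpace (𝓡 d) p →L[ℝ] ℝ :=
  haveI : FiniteDimensional ℝ (TangentSpace (𝓡 d) p) :=
    inferInstanceAs (FiniteDimensional ℝ (EuclideanSpace ℝ (Fin d)))
  haveI : T2Space (TangentSpace (𝓡 d) p) := inferInstanceAs (T2Space (EuclideanSpace ℝ (Fin d)))
  LinearMap.toContinuousBilinearMap
    ((varpi (E.fiber (i p))).compl₁₂
      ((mfderiv (𝓡 d) (𝓡 m) i p).toLinearMap.codRestrict (E.charDist (i p)) (hi.mem p))
      ((mfderiv (𝓡 d) (𝓡 m) i p).toLinearMap.codRestrict (E.charModule (i p))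
        fun X => E.charDist_le (i p) (hi.mem p X)))

theorem IsIntegralManifold.form_apply (hi : E.IsIntegralManifold (d := d) i) (p : N)
    (X Y : TangentSpace (𝓡 d) p) : hi.form p X Y =
    E.varpiRestr (i p) ⟨mfderiv (𝓡 d) (𝓡 m) i p X, hi.mem p X⟩
          ⟨mfderiv (𝓡 d) (𝓡 m) i p Y, hi.mem p Y⟩ := rfl

theorem IsIntegralManifold.form_eq (hi : E.IsIntegralManifold (d := d) i) {p : N}
    {a : BigTangent m (i p)} (ha : a ∈ E.fiber (i p)) {X : TangentSpace (𝓡 d) p}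
    (hX : mfderiv (𝓡 d) (𝓡 m) i p X = a.1) (Y : TangentSpace (𝓡 d) p) :
    hi.form p X Y = a.2 (mfderiv (𝓡 d) (𝓡 m) i p Y) := by
  rw [hi.form_apply, E.varpiRestr_eq ha _ _ hX.symm]

theorem IsIntegralManifold.exists_mem_fiber (hi : E.IsIntegralManifold (d := d) i) (p : N)
    (X : TangentSpace (𝓡 d) p) : ∃ a ∈ E.fiber (i p), mfderiv (𝓡 d) (𝓡 m) i p X = a.1 := by
  obtain ⟨a, ha, h⟩ := exists_mem_of_mem_prT (hi.mem p X)
  exact ⟨a, ha, h.symm⟩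

/-- For lifts `(i_*X, α)` and `(i_*Y, β)` in `E`, isotropy says `α(i_*Y) + β(i_*X) = 0`. -/
theorem IsIntegralManifold.form_skew (hi : E.IsIntegralManifold (d := d) i) (p : N)
    (X Y : TangentSpace (𝓡 d) p) : hi.form p X Y = - hi.form p Y X := by
  obtain ⟨a, ha, hX⟩ := hi.exists_mem_fiber p X
  obtain ⟨b, hb, hY⟩ := hi.exists_mem_fiber p Y
  have h := E.isotropic _ a ha b hb
  rw [hi.form_eq ha hX, hi.form_eq hb hY, hX, hY]
  simp only [gPair] at h
  linarith

/-- The vector field induced on an integral submanifold by a section of `E`. -/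
theorem IsIntegralManifold.exists_related (hi : E.IsIntegralManifold (d := d) i)
    {a : ∀ x : M, BigTangent m x} (ha : E.IsSection a) :
    ∃ X : ∀ p : N, TangentSpace (𝓡 d) p, SmoothFieldOn X univ ∧
      ∀ p, mfderiv (𝓡 d) (𝓡 m) i p (X p) = (a (i p)).1 := by
  have h : ∀ p, ∃ X, mfderiv (𝓡 d) (𝓡 m) i p X = (a (i p)).1 := by
    intro p
    have : (a (i p)).1 ∈ (mfderiv (𝓡 d) (𝓡 m) i p).range := by
      rw [hi.tangent p]
      exact mem_prT (ha.2 (i p))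
    exact this
  choose X hX using h
  exact ⟨X, SmoothFieldOn.of_related hi.smooth hi.immersion ha.1.1 hX, hX⟩

/-- The vector fields on an integral submanifold that are induced by sections of `E`. -/
def IsIntegralManifold.inducedFields (_hi : E.IsIntegralManifold (d := d) i) :
    Set (∀ p : N, TangentSpace (𝓡 d) p) :=
  {X | SmoothFieldOn X univ ∧
    ∃ a, E.IsSection a ∧ ∀ p, mfderiv (𝓡 d) (𝓡 m) i p (X p) = (a (i p)).1}

theorem IsIntegralManifold.exists_mem_inducedFields [T2Space M]
    (hi : E.IsIntegralManifold (d := d) i) (p : N) (v : TangentSpace (𝓡 d) p) :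
    ∃ X ∈ hi.inducedFields, X p = v := by
  obtain ⟨a₀, ha₀, hv⟩ := hi.exists_mem_fiber p v
  obtain ⟨a, ha, rfl⟩ := E.exists_isSection ha₀
  obtain ⟨X, hXs, hX⟩ := hi.exists_related ha
  exact ⟨X, ⟨hXs, a, ha, hX⟩, hi.immersion p ((hX p).trans hv.symm)⟩

theorem IsIntegralManifold.contMDiff_form_apply (hi : E.IsIntegralManifold (d := d) i)
    {X Y : ∀ p : N, TangentSpace (𝓡 d) p} (hX : X ∈ hi.inducedFields) (hY : Y ∈ hi.inducedFields) :
    ContMDiff (𝓡 d) 𝓘(ℝ, ℝ) ∞ fun p => hi.form p (X p) (Y p) := by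
  obtain ⟨-, a, ha, hXa⟩ := hX
  obtain ⟨-, b, hb, hYb⟩ := hY
  have h : (fun p => hi.form p (X p) (Y p)) = (fun x => (a x).2 (b x).1) ∘ i := by
    funext p
    rw [hi.form_eq (ha.2 (i p)) (hXa p), hYb, Function.comp_apply]
  rw [h]
  exact (ha.1.2.apply hb.1.1).comp hi.smooth

theorem IsIntegralManifold.contMDiff_form [T2Space M] (hi : E.IsIntegralManifold (d := d) i) :
    ContMDiff (𝓡 d)
    ((𝓡 d).prod 𝓘(ℝ, EuclideanSpace ℝ (Fin d) →L[ℝ] EuclideanSpace ℝ (Fin d) →L[ℝ] ℝ)) ∞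
    (fun x => TotalSpace.mk' (EuclideanSpace ℝ (Fin d) →L[ℝ] EuclideanSpace ℝ (Fin d) →L[ℝ] ℝ)
      (E := fun x : N => TangentSpace (𝓡 d) x →L[ℝ] TangentSpace (𝓡 d) x →L[ℝ] ℝ) x
      (hi.form x)) :=
  contMDiff_bilinear_of_forall_exists_field hi.inducedFields (fun _ hX => hX.1)
    hi.exists_mem_inducedFields fun _ hX _ hY => hi.contMDiff_form_apply hX hY

/-- The Courant bracket condition for three sections of `E` says that the exterior derivative of
the induced 2-form vanishes on the induced vector fields. -/
theorem IsIntegralManifold.extDerivForm_inducedFields (hi : E.IsIntegralManifold (d := d) i)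
    (hE : E.Integrable) {X Y Z : ∀ p : N, TangentSpace (𝓡 d) p} (hX : X ∈ hi.inducedFields)
    (hY : Y ∈ hi.inducedFields) (hZ : Z ∈ hi.inducedFields) (p : N) :
    extDerivForm hi.form X Y Z p = 0 := by
  have hXY := hi.contMDiff_form_apply hX hY
  obtain ⟨hXs, a, ha, hXa⟩ := hX
  obtain ⟨hYs, b, hb, hYb⟩ := hY
  obtain ⟨hZs, c, hc, hZc⟩ := hZ
  have : IsManifold (𝓡 d) 2 N := inferInstance
  have : IsManifold (𝓡 m) 2 M := inferInstance
  have bracket : ∀ {V W : ∀ p : N, TangentSpace (𝓡 d) p} {v w : ∀ x : M, BigTangent m x},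
      SmoothFieldOn V univ → SmoothFieldOn W univ → E.IsSection v → E.IsSection w →
      (∀ p, mfderiv (𝓡 d) (𝓡 m) i p (V p) = (v (i p)).1) →
      (∀ p, mfderiv (𝓡 d) (𝓡 m) i p (W p) = (w (i p)).1) →
      mfderiv (𝓡 d) (𝓡 m) i p (mlieBracket (𝓡 d) V W p) =
        mlieBracket (𝓡 m) (fun x => (v x).1) (fun x => (w x).1) (i p) :=
    fun hV hW hv hw h h' => mfderiv_mlieBracket_of_related (contMDiff_infty.1 hi.smooth 2 p)
      (hV.diffFieldAt p) (hW.diffFieldAt p) (hv.1.1.diffFieldAt _) (hw.1.1.diffFieldAt _) h h'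
  have pair : ∀ {V W : ∀ p : N, TangentSpace (𝓡 d) p} {v w : ∀ x : M, BigTangent m x},
      E.IsSection v →
      (∀ p, mfderiv (𝓡 d) (𝓡 m) i p (V p) = (v (i p)).1) →
      (∀ p, mfderiv (𝓡 d) (𝓡 m) i p (W p) = (w (i p)).1) → ∀ q,
      (v (i q)).2 (w (i q)).1 = hi.form q (V q) (W q) := by
    intro V W v w hv h h' q
    rw [hi.form_eq (hv.2 (i q)) (h q), h']
  obtain ⟨e, he, he₁, he₂⟩ := hE a b ha hb
  have key := he₂ (fun x => (c x).1) hc.1.1 (i p)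
  -- The bracket `e` lies in `E` with vector part `i_*[X, Y]`, so its form part computes `σ([X, Y],
  -- ·)`.
  have h₁ : (e (i p)).2 (c (i p)).1 = hi.form p (mlieBracket (𝓡 d) X Y p) (Z p) := by
    rw [hi.form_eq (he.2 (i p)) ((bracket hXs hYs ha hb hXa hYb).trans (he₁ (i p)).symm), hZc]
  -- By skewness the two pairings add up; this 2 cancels the factor `1/2` of the Courant bracket.
  have h₂ : ∀ q, (a (i q)).2 (b (i q)).1 - (b (i q)).2 (a (i q)).1 =
      2 * hi.form q (X q) (Y q) := by
    intro q
    rw [pair ha hXa hYb, pair hb hYb hXa, hi.form_skew q (Y q) (X q)]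
    ring
  have hab : ContMDiff (𝓡 m) 𝓘(ℝ, ℝ) ∞ fun x => (a x).2 (b x).1 - (b x).2 (a x).1 :=
    (ha.1.2.apply hb.1.1).sub (hb.1.2.apply ha.1.1)
  simp only [lieDerivForm] at key
  -- On the leaf `key` becomes `σ([X,Y],Z) = Xσ(Y,Z) - σ(Y,[X,Z]) - Yσ(X,Z) + σ(X,[Y,Z]) + Zσ(X,Y)`,
  -- which is `dσ(X,Y,Z) = 0` up to skewness.
  rw [h₁, dirDeriv_of_related hi.smooth (hXa p) (hb.1.2.apply hc.1.1) (pair hb hYb hZc),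
    dirDeriv_of_related hi.smooth (hYb p) (ha.1.2.apply hc.1.1) (pair ha hXa hZc),
    dirDeriv_of_related hi.smooth (hZc p) hab h₂,
    dirDeriv_const_mul 2 ((hXY p).mdifferentiableAt (by simp)),
    ← bracket hXs hZs ha hc hXa hZc, ← bracket hYs hZs hb hc hYb hZc,
    ← hi.form_eq (hb.2 (i p)) (hYb p), ← hi.form_eq (ha.2 (i p)) (hXa p)] at key
  have hZX : dirDeriv Y (fun q => hi.form q (Z q) (X q)) p =
      - dirDeriv Y (fun q => hi.form q (X q) (Z q)) p := by
    rw [dirDeriv_congr fun q => hi.form_skew q (Z q) (X q), dirDeriv_neg]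
  have hXZ : hi.form p (mlieBracket (𝓡 d) Z X p) (Y p) =
      hi.form p (Y p) (mlieBracket (𝓡 d) X Z p) := by
    rw [mlieBracket_swap_apply, map_neg, hi.form_skew p (Y p)]
    rfl
  rw [extDerivForm, hZX, hXZ, hi.form_skew p (mlieBracket (𝓡 d) Y Z p) (X p)]
  linarith

/-- The form induced on an integral submanifold of an integrable big-isotropic structure is
presymplectic. -/
theorem IsIntegralManifold.isPresymplecticForm_form [T2Space M]
    (hi : E.IsIntegralManifold (d := d) i) (hE : E.Integrable) : IsPresymplecticForm hi.form where
  skew := hi.form_skew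
  smooth := hi.contMDiff_form
  closed := by
    intro X Y Z hX hY hZ p
    obtain ⟨X', hX', hXX'⟩ := hi.exists_mem_inducedFields p (X p)
    obtain ⟨Y', hY', hYY'⟩ := hi.exists_mem_inducedFields p (Y p)
    obtain ⟨Z', hZ', hZZ'⟩ := hi.exists_mem_inducedFields p (Z p)
    -- At `p` only the values of the fields matter, so they are replaced by induced fields with the
    -- same values there.
    refine (extDerivForm_eq_of_apply_eq ((hi.contMDiff_form p).mdifferentiableAt (by simp))
      hi.form_skew (hX.diffFieldAt p) (hY.diffFieldAt p) (hZ.diffFieldAt p) (hX'.1.diffFieldAt p)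
      (hY'.1.diffFieldAt p) (hZ'.1.diffFieldAt p) hXX'.symm hYY'.symm hZZ'.symm).trans ?_
    exact hi.extDerivForm_inducedFields hE hX' hY' hZ' p

theorem IsIntegralManifold.pullback_fiber (hi : E.IsIntegralManifold (d := d) i) (p : N) :
    pullback (n := d) i E.fiber p = graphForm hi.form p := by
  ext a
  constructor
  · rintro ⟨α, hα, ha⟩
    refine ContinuousLinearMap.ext fun Y => ?_
    rw [ha]
    exact (hi.form_eq hα rfl Y).symm
  · intro ha
    have ha' : a.2 = hi.form p a.1 := ha
    obtain ⟨b, hb, h⟩ := hi.exists_mem_fiber p a.1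
    refine ⟨b.2, ?_, ContinuousLinearMap.ext fun Y => ?_⟩
    · rw [h]
      exact hb
    · rw [ha', hi.form_eq hb h Y]
      rfl

theorem IsIntegralManifold.pullback_diracExt (hi : E.IsIntegralManifold (d := d) i) (p : N) :
    pullback (n := d) i E.diracExt p = graphForm hi.form p := by
  ext a
  constructor
  · rintro ⟨α, ⟨_, hα⟩, ha⟩
    refine ContinuousLinearMap.ext fun Y => ?_
    rw [ha]
    exact (hα ⟨mfderiv (𝓡 d) (𝓡 m) i p Y, hi.mem p Y⟩).trans (hi.form_apply p a.1 Y).symm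
  · intro ha
    -- A graph element already comes from `E`, and `E ⊆ D(E)`.
    rw [← hi.pullback_fiber] at ha
    obtain ⟨α, hα, ha⟩ := ha
    exact ⟨α, ⟨hi.mem p a.1, fun Y => (E.varpiRestr_eq hα _ Y rfl).symm⟩, ha⟩

end BigIsotropic

end Dirac

end BigIso

end

theorem proposition4p2 {m k d : ℕ}
    {M : Type*} [TopologicalSpace M] [T2Space M] [ChartedSpace (EuclideanSpace ℝ (Fin m)) M]
    [IsManifold (𝓡 m) ∞ M]
    (E : BigIso.BigIsotropic m k M) (hE : E.Integrable)
    {S : Type*} [TopologicalSpace S] [ChartedSpace (EuclideanSpace ℝ (Fin d)) S]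
    [IsManifold (𝓡 d) ∞ S]
    (i : S → M) (hi : E.IsCharacteristicLeaf (d := d) i) :
    (∀ p : S, BigIso.pullback (n := d) i E.fiber p = BigIso.pullback (n := d) i E.diracExt p) ∧
    ∃ σ : ∀ p : S, TangentSpace (𝓡 d) p →L[ℝ] TangentSpace (𝓡 d) p →L[ℝ] ℝ,
      BigIso.IsPresymplecticForm σ ∧
      (∀ (p : S) (X Y : TangentSpace (𝓡 d) p),
        σ p X Y = E.varpiRestr (i p) ⟨mfderiv (𝓡 d) (𝓡 m) i p X, hi.mem p X⟩
          ⟨mfderiv (𝓡 d) (𝓡 m) i p Y, hi.mem p Y⟩) ∧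
      ∀ p : S, BigIso.pullback (n := d) i E.fiber p = BigIso.graphForm σ p := by
  have hi' := hi.toIsIntegralManifold
  exact ⟨fun p => (hi'.pullback_fiber p).trans (hi'.pullback_diracExt p).symm, hi'.form,
    hi'.isPresymplecticForm_form hE, hi'.form_apply, hi'.pullback_fiber⟩
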